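/- Let $q$ be a prime power, let $t,t'\ge 1$ be integers and put $n=tt'$; consider the finite fields $\mathbb{F}_q\subseteq\mathbb{F}_{q^t}\subseteq\mathbb{F}_{q^n}$. A polynomial $f\in\mathbb{F}_{q^n}[x]$ is called R-$q^t$-partially scattered if for all $y,z\in\mathbb{F}_{q^n}^*$, $$\frac{f(y)}{y}=\frac{f(z)}{z}\ \text{ and }\ \frac{y}{z}\in\mathbb{F}_{q^t}\ \Longrightarrow\ \frac{y}{z}\in\mathbb{F}_q .$$ For $f\in\mathbb{F}_{q^n}[x]$ put $U_f=\{(x,f(x)) : x\in\mathbb{F}_{q^n}\}\subseteq\mathbb{F}_{q^n}\times\mathbb{F}_{q^n}$. Two polynomials $f,g$ that induce $\mathbb{F}_q$-linear maps on $\mathbb{F}_{q^n}$ are called weakly equivalent if there is $\varphi\in\Gamma\mathrm{L}(2t',q^t)$, i.e. an invertible $\mathbb{F}_{q^t}$-semilinear map $\varphi$ (with respect to some field automorphism of $\mathbb{F}_{q^t}$) of the $2t'$-dimensional $\mathbb{F}_{q^t}$-vector space $\mathbb{F}_{q^n}\times\mathbb{F}_{q^n}$, such that $\varphi(U_f)=U_g$.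 Let $s,s'$ be non-negative integers with $\gcd(s,t)=\gcd(s',t)=1$, and let $$f(x)=\sum_{i=0}^{t'-1}a_i x^{q^{it+s}},\qquad g(x)=\sum_{i=0}^{t'-1}b_i x^{q^{it+s'}}\qquad(a_i,b_i\in\mathbb{F}_{q^n})$$ be two R-$q^t$-partially scattered polynomials. Then $f$ and $g$ are weakly equivalent if and only if $s\equiv s'\pmod t$ or $s\equiv -s'\pmod t$. -/

import Mathlib

open Polynomial

/-- The polynomial `∑ a_i X^(q^(i t + s))`, where `i` runs over `0, …, t' - 1`. -/
noncomputable def qtPolynomial {L : Type*} [Field L] (q t t' s : ℕ) (a : Fin t' → L) : L[X] :=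
  ∑ i : Fin t', C (a i) * X ^ (q ^ ((i : ℕ) * t + s))

/-- For a tower of finite fields `F ⊆ K ⊆ L` with `|F| = q`, `|K| = q ^ t`: the polynomial `f` over
`L` is R-`q^t`-partially scattered (of index `0`) if for all nonzero `y, z` in `L`,
`f(y)/y = f(z)/z` and `y/z ∈ K` imply `y/z ∈ F`. -/
def IsRPartiallyScattered (F K : Type*) {L : Type*} [Field F] [Field K] [Field L]
    [Algebra F L] [Algebra K L] (f : L[X]) : Prop :=
  ∀ y z : L, y ≠ 0 → z ≠ 0 → f.eval y / y = f.eval z / z →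
    y / z ∈ (algebraMap K L).range → y / z ∈ (algebraMap F L).range

/-- The set `U_f = {(x, f(x)) : x ∈ L}` in `L × L`. -/
def polyGraph {L : Type*} [Field L] (f : L[X]) : Set (L × L) :=
  {v | ∃ x : L, v = (x, f.eval x)}

/-- `f` and `g` are weakly equivalent with respect to the subfield `K` of `L`: some invertible
`K`-semilinear map of the `K`-vector space `L × L`, with respect to some field automorphism of `K`,
maps `U_f` onto `U_g`. -/
def WeaklyEquivalent (K : Type*) {L : Type*} [Field K] [Field L] [Algebra K L]
    (f g : L[X]) : Prop :=
  ∃ (σ : K ≃+* K) (φ : (L × L) →ₛₗ[(σ : K →+* K)] (L × L)),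
    Function.Bijective φ ∧ φ '' polyGraph f = polyGraph g

/-! Since f(μx) = μ^(q^s) f(x) for μ in K, and likewise for g with s', both maps are semilinear over
K; for t ≠ 1 scatteredness makes them bijective. If s ≡ s', then g ∘ f⁻¹ is K-linear; if s ≡ -s',
then g ∘ f is. Applied to one coordinate, after a swap in the second case, it carries U_f onto U_g.
Conversely, a weak equivalence restricted to the line Kx gives a relation between the powers μ^(q^e)
with e = 0, s, s', s + s'. If both congruences failed, these would be distinct characters of K, and
their independence would force φ to vanish on L × 0. -/

/-- The power map `x ↦ x ^ (q ^ k)` on an extension of a finite field of order `q`, as a linear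
map over that field. -/
noncomputable def frobeniusPow (F L : Type*) [Field F] [Field L] [Finite F] [Algebra F L] (k : ℕ) :
    L →ₗ[F] L :=
  letI := Fintype.ofFinite F
  ((FiniteField.frobeniusAlgHom F L) ^ k).toLinearMap

theorem frobeniusPow_apply {F L : Type*} [Field F] [Field L] [Finite F] [Algebra F L] (k : ℕ)
    (x : L) : frobeniusPow F L k x = x ^ (Nat.card F ^ k) := by
  let := Fintype.ofFinite F
  have h : ∀ y : L, ((FiniteField.frobeniusAlgHom F L) ^ k) y = y ^ (Nat.card F ^ k) := by
    induction k with
    | zero => simp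
    | succ k ih =>
      intro y
      rw [pow_succ, AlgHom.mul_apply, ih, FiniteField.frobeniusAlgHom_apply, ← pow_mul,
        Nat.card_eq_fintype_card, pow_succ, mul_comm]
  exact h x

theorem pow_card_pow_eq_iff_modEq {F K : Type*} [Field F] [Field K] [Finite K]
    [Algebra F K] (i j : ℕ) :
    (∀ μ : K, μ ^ (Nat.card F ^ i) = μ ^ (Nat.card F ^ j)) ↔
      i ≡ j [MOD Module.finrank F K] := by
  have : Finite F := Finite.of_injective _ (algebraMap F K).injective
  let := Fintype.ofFinite F
  rw [← FiniteField.orderOf_frobeniusAlgEquivOfAlgebraic F K, ← pow_eq_pow_iff_modEq,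
    AlgEquiv.ext_iff]
  have h : ∀ (k : ℕ) (y : K),
      ((FiniteField.frobeniusAlgEquivOfAlgebraic F K) ^ k) y = y ^ (Nat.card F ^ k) := by
    intro k
    induction k with
    | zero => simp
    | succ k ih =>
      intro y
      rw [pow_succ, AlgEquiv.mul_apply, ih, FiniteField.frobeniusAlgEquivOfAlgebraic_apply,
        ← pow_mul, Nat.card_eq_fintype_card, pow_succ, mul_comm]
  simp only [h]

section qtPolynomial

variable {F K L : Type*} [Field F] [Field K] [Field L] [Finite L]
  [Algebra F K] [Algebra K L]

theorem eval_qtPolynomial {L : Type*} [Field L] (q t t' s : ℕ) (a : Fin t' → L) (x : L) :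
    (qtPolynomial q t t' s a).eval x = ∑ i : Fin t', a i * x ^ (q ^ ((i : ℕ) * t + s)) := by
  simp [qtPolynomial, eval_finsetSum]

theorem eval_qtPolynomial_add {F L : Type*} [Field F] [Field L] [Algebra F L] [Finite F]
    (t t' s : ℕ) (a : Fin t' → L) (x y : L) :
    (qtPolynomial (Nat.card F) t t' s a).eval (x + y) =
      (qtPolynomial (Nat.card F) t t' s a).eval x +
        (qtPolynomial (Nat.card F) t t' s a).eval y := by
  simp only [eval_qtPolynomial, ← frobeniusPow_apply, map_add, mul_add, Finset.sum_add_distrib]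

/-- The polynomial `∑ a_i X^(q^(i t + s))` induces a map that is semilinear over the subfield of
order `q ^ t`, with respect to `μ ↦ μ ^ (q ^ s)`. -/
theorem eval_qtPolynomial_smul (t' s : ℕ) (a : Fin t' → L) (μ : K) (x : L) :
    (qtPolynomial (Nat.card F) (Module.finrank F K) t' s a).eval (μ • x) =
      μ ^ (Nat.card F ^ s) •
        (qtPolynomial (Nat.card F) (Module.finrank F K) t' s a).eval x := by
  have : Finite K := Finite.of_injective _ (algebraMap K L).injective
  simp only [eval_qtPolynomial, Finset.smul_sum]
  refine Finset.sum_congr rfl fun i _ => ?_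
  rw [_root_.smul_pow, (pow_card_pow_eq_iff_modEq (F := F) (K := K) _ s).2 (by simp [Nat.ModEq]) μ,
    mul_smul_comm]

/-- Over a proper extension `K / F`, a partially scattered `∑ a_i X^(q^(i t + s))` induces an
injective map. -/
theorem IsRPartiallyScattered.injective [Algebra F L] [IsScalarTower F K L] (t' s : ℕ)
    (a : Fin t' → L)
    (hf : IsRPartiallyScattered F K
      (qtPolynomial (Nat.card F) (Module.finrank F K) t' s a))
    (ht : Module.finrank F K ≠ 1) :
    Function.Injective
      fun x => (qtPolynomial (Nat.card F) (Module.finrank F K) t' s a).eval x := by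
  have : Finite K := Finite.of_injective _ (algebraMap K L).injective
  have : Finite F := Finite.of_injective _ (algebraMap F K).injective
  let f : L →+ L := AddMonoidHom.mk'
    (fun x => (qtPolynomial (Nat.card F) (Module.finrank F K) t' s a).eval x)
    (eval_qtPolynomial_add (F := F) (Module.finrank F K) t' s a)
  refine (injective_iff_map_eq_zero f).2 fun z hz => ?_
  change eval z _ = 0 at hz
  by_contra hz0
  apply ht
  -- The map vanishes on all of Kz, so f(y)/y = 0 there and scatteredness puts every w in K into F.
  rw [finrank_eq_one_iff']
  refine ⟨1, one_ne_zero, fun w => ?_⟩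
  rcases eq_or_ne w 0 with rfl | hw
  · exact ⟨0, zero_smul _ _⟩
  have hwL : algebraMap K L w ≠ 0 := by simpa using hw
  have hdiv : (w • z) / z = algebraMap K L w := by
    rw [Algebra.smul_def, mul_div_cancel_right₀ _ hz0]
  have := hf (w • z) z (by rw [Algebra.smul_def]; exact mul_ne_zero hwL hz0) hz0
    (by rw [eval_qtPolynomial_smul, hz]; simp) (by rw [hdiv]; exact ⟨w, rfl⟩)
  rw [hdiv] at this
  obtain ⟨c, hc⟩ := this
  refine ⟨c, (algebraMap K L).injective ?_⟩
  rw [← hc, IsScalarTower.algebraMap_apply F K L, Algebra.smul_def, mul_one]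

end qtPolynomial

section WeaklyEquivalent

variable {K L : Type*} [Field K] [Field L] [Algebra K L]

/-- An invertible `K`-linear map of `L × L` that carries the graph of `f` onto the graph of `g`
gives a weak equivalence. -/
theorem weaklyEquivalent_of_linearEquiv {f g : L[X]} (φ : (L × L) ≃ₗ[K] (L × L)) (e : L → L)
    (he : Function.Surjective e) (h : ∀ x, φ (x, f.eval x) = (e x, g.eval (e x))) :
    WeaklyEquivalent K f g := by
  refine ⟨RingEquiv.refl K, φ.toLinearMap, φ.bijective, ?_⟩
  ext v
  constructor
  · rintro ⟨_, ⟨x, rfl⟩, rfl⟩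
    exact ⟨e x, h x⟩
  · rintro ⟨y, rfl⟩
    obtain ⟨x, rfl⟩ := he y
    exact ⟨_, ⟨x, rfl⟩, h x⟩

/-- Two polynomials inducing `K`-linear maps are weakly equivalent. -/
theorem weaklyEquivalent_of_linear {f g : L[X]} (f' g' : L →ₗ[K] L)
    (hf : ∀ x, f.eval x = f' x) (hg : ∀ x, g.eval x = g' x) : WeaklyEquivalent K f g := by
  refine weaklyEquivalent_of_linearEquiv
    ((LinearEquiv.refl K L).skewProd (LinearEquiv.refl K L) (g' - f')) id
    Function.surjective_id fun x => ?_
  simp [LinearEquiv.skewProd_apply, hf, hg]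

/-- If `ψ` is a bijective `K`-linear map with `ψ ∘ f = g`, then `f` and `g` are weakly
equivalent. -/
theorem weaklyEquivalent_of_comp_eq {f g : L[X]} (ψ : L ≃ₗ[K] L)
    (h : ∀ x, ψ (f.eval x) = g.eval x) : WeaklyEquivalent K f g :=
  weaklyEquivalent_of_linearEquiv ((LinearEquiv.refl K L).prodCongr ψ) id
    Function.surjective_id fun x => Prod.ext rfl (h x)

/-- If `f` induces a surjective map and `g ∘ f` is a bijective `K`-linear map, then `f` and `g` are
weakly equivalent. -/
theorem weaklyEquivalent_of_eval_eval {f g : L[X]} (ψ : L ≃ₗ[K] L)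
    (hf : Function.Surjective fun x => f.eval x)
    (h : ∀ x, ψ x = g.eval (f.eval x)) : WeaklyEquivalent K f g :=
  weaklyEquivalent_of_linearEquiv
    ((LinearEquiv.prodComm K L L).trans ((LinearEquiv.refl K L).prodCongr ψ)) _ hf
    fun x => Prod.ext rfl (h x)

end WeaklyEquivalent

/-- Four powers of the Frobenius of `K / F` whose exponents are pairwise incongruent modulo
`[K : F]` are linearly independent over an extension of `K`. -/
theorem eq_zero_of_sum_pow_smul_eq_zero {F K L : Type*} [Field F] [Field K] [Field L] [Finite K]
    [Algebra F K] [Algebra K L] {ι : Type*} [Fintype ι] (e : ι → ℕ)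
    (he : ∀ i j, e i ≡ e j [MOD Module.finrank F K] → i = j) (c : ι → L)
    (h : ∀ μ : K, ∑ i, μ ^ (Nat.card F ^ e i) • c i = 0) (i : ι) : c i = 0 := by
  let χ : ι → (K →* L) := fun i => (algebraMap K L : K →* L).comp (powMonoidHom (Nat.card F ^ e i))
  have hχ : Function.Injective χ := fun i j hij => by
    refine he i j ((pow_card_pow_eq_iff_modEq _ _).1 fun μ => (algebraMap K L).injective ?_)
    exact DFunLike.congr_fun hij μ
  -- Dedekind's independence of characters.
  have hli := (linearIndependent_monoidHom K L).comp χ hχ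
  refine Fintype.linearIndependent_iff.1 hli c (funext fun μ => ?_) i
  simpa [χ, Algebra.smul_def, Finset.sum_apply, mul_comm] using h μ

theorem modEq_or_modEq_neg_of_weaklyEquivalent {F K L : Type*} [Field F] [Field K] [Field L]
    [Finite L] [Algebra F K] [Algebra K L] [Algebra F L]
    (s s' t' : ℕ) (a b : Fin t' → L)
    (hs : ¬ s ≡ 0 [MOD Module.finrank F K]) (hs' : ¬ s' ≡ 0 [MOD Module.finrank F K])
    (hg : Function.Injective
      fun x => (qtPolynomial (Nat.card F) (Module.finrank F K) t' s' b).eval x)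
    (h : WeaklyEquivalent K (qtPolynomial (Nat.card F) (Module.finrank F K) t' s a)
      (qtPolynomial (Nat.card F) (Module.finrank F K) t' s' b)) :
    s ≡ s' [MOD Module.finrank F K] ∨ s + s' ≡ 0 [MOD Module.finrank F K] := by
  have : Finite K := Finite.of_injective _ (algebraMap K L).injective
  have : Finite F := Finite.of_injective _ (algebraMap F K).injective
  have hfs := eval_qtPolynomial_smul (F := F) (K := K) t' s a
  have hgs := eval_qtPolynomial_smul (F := F) (K := K) t' s' b
  have hga := eval_qtPolynomial_add (F := F) (Module.finrank F K) t' s' b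
  set f := qtPolynomial (Nat.card F) (Module.finrank F K) t' s a
  set g := qtPolynomial (Nat.card F) (Module.finrank F K) t' s' b
  by_contra! hne
  obtain ⟨hne, hne'⟩ := hne
  obtain ⟨σ, φ, hφ, hφU⟩ := h
  have hg0 : g.eval 0 = 0 := by simpa using hga 0 0
  have key : ∀ x, g.eval (φ (x, f.eval x)).1 = (φ (x, f.eval x)).2 := by
    intro x
    have : φ (x, f.eval x) ∈ polyGraph g := hφU ▸ ⟨_, ⟨x, rfl⟩, rfl⟩
    obtain ⟨u, hu⟩ := this
    rw [hu]
  have hsplit : ∀ x y, φ (x, y) = φ (x, 0) + φ (0, y) := fun x y => by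
    rw [← map_add]; simp
  have hsmul₁ : ∀ (μ : K) x, φ (μ • x, 0) = σ μ • φ (x, 0) := fun μ x => by
    have := φ.map_smulₛₗ μ (x, 0)
    simpa using this
  have hsmul₂ : ∀ (μ : K) y, φ (0, μ • y) = σ μ • φ (0, y) := fun μ y => by
    have := φ.map_smulₛₗ μ (0, y)
    simpa using this
  have hall : ∀ x, φ (x, 0) = 0 := by
    intro x
    -- Coefficients of `key` at μx, expanded in powers of ν = σ μ; σ commutes with powers, so it
    -- leaves the exponents unchanged.
    have hz := eq_zero_of_sum_pow_smul_eq_zero (F := F) (K := K) (L := L)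
      ![0, s, s', s + s']
      (by
        have h1 : ¬ s + s' ≡ s [MOD Module.finrank F K] := fun h =>
          hs' (Nat.ModEq.add_left_cancel' s (h.trans (by simp [Nat.ModEq])))
        have h2 : ¬ s + s' ≡ s' [MOD Module.finrank F K] := fun h =>
          hs (Nat.ModEq.add_right_cancel' s' (h.trans (by simp [Nat.ModEq])))
        intro i j hij
        fin_cases i <;> fin_cases j <;> first
          | rfl
          | exact absurd hij (by assumption)
          | exact absurd hij.symm (by assumption))
      ![-(φ (x, 0)).2, -(φ (0, f.eval x)).2, g.eval (φ (x, 0)).1,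
        g.eval (φ (0, f.eval x)).1]
      (by
        intro ν
        obtain ⟨μ, rfl⟩ := σ.surjective ν
        have := key (μ • x)
        rw [hfs, hsplit, hsmul₁, hsmul₂, map_pow, Prod.fst_add, Prod.snd_add, hga, Prod.smul_fst,
          Prod.smul_fst, Prod.smul_snd, Prod.smul_snd, hgs, hgs, ← pow_mul, ← pow_add] at this
        simp only [Fin.sum_univ_four, Matrix.cons_val, pow_zero, pow_one, smul_neg]
        linear_combination this)
    have z0 := hz 0
    have z2 := hz 2
    simp only [Matrix.cons_val, neg_eq_zero] at z0 z2
    exact Prod.ext (hg (z2.trans hg0.symm)) z0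
  have hzero : φ (1, 0) = φ 0 := (hall 1).trans (map_zero φ).symm
  exact one_ne_zero (congrArg Prod.fst (hφ.1 hzero))

theorem mainTheorem8 {F K L : Type*} [Field F] [Field K] [Field L] [Finite L]
    [Algebra F K] [Algebra K L] [Algebra F L] [IsScalarTower F K L]
    (q t t' : ℕ) (hq : Nat.card F = q) (ht : Module.finrank F K = t)
    (ht' : Module.finrank K L = t')
    (s s' : ℕ) (hs : Nat.gcd s t = 1) (hs' : Nat.gcd s' t = 1)
    (a b : Fin t' → L)
    (hf : IsRPartiallyScattered F K (qtPolynomial q t t' s a))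
    (hg : IsRPartiallyScattered F K (qtPolynomial q t t' s' b)) :
    WeaklyEquivalent K (qtPolynomial q t t' s a) (qtPolynomial q t t' s' b) ↔
      ((s : ℤ) ≡ (s' : ℤ) [ZMOD (t : ℤ)] ∨ (s : ℤ) ≡ -(s' : ℤ) [ZMOD (t : ℤ)]) := by
  have : Finite K := Finite.of_injective _ (algebraMap K L).injective
  have : Finite F := Finite.of_injective _ (algebraMap F K).injective
  have hmod : ((s : ℤ) ≡ -(s' : ℤ) [ZMOD (t : ℤ)]) ↔ s + s' ≡ 0 [MOD t] := by
    rw [← Int.natCast_modEq_iff, Int.modEq_iff_dvd, Int.modEq_iff_dvd]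
    push_cast
    rw [show -(s' : ℤ) - s = 0 - (s + s') by ring]
  rw [Int.natCast_modEq_iff, hmod]
  subst hq ht
  have hpow := fun i j => (pow_card_pow_eq_iff_modEq (F := F) (K := K) i j).2
  have hfs := eval_qtPolynomial_smul (F := F) (K := K) t' s a
  have hgs := eval_qtPolynomial_smul (F := F) (K := K) t' s' b
  have hfa := eval_qtPolynomial_add (F := F) (Module.finrank F K) t' s a
  have hga := eval_qtPolynomial_add (F := F) (Module.finrank F K) t' s' b
  -- For t = 1 injectivity may fail, but both maps are K-linear and a shear by their difference
  -- suffices.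
  by_cases h1 : Module.finrank F K = 1
  · have hid : ∀ k (μ : K), μ ^ (Nat.card F ^ k) = μ := fun k μ => by
      simpa using hpow k 0 (by rw [h1]; exact Nat.modEq_one) μ
    simp only [hid] at hfs hgs
    refine ⟨fun _ => Or.inl (by rw [h1]; exact Nat.modEq_one), fun _ => ?_⟩
    exact weaklyEquivalent_of_linear (K := K) ⟨⟨_, hfa⟩, hfs⟩ ⟨⟨_, hga⟩, hgs⟩
      (fun _ => rfl) (fun _ => rfl)
  have hfi := hf.injective t' s a h1
  have hgi := hg.injective t' s' b h1
  have hfb := Finite.injective_iff_bijective.1 hfi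
  have hgb := Finite.injective_iff_bijective.1 hgi
  have hne : ∀ k, Nat.gcd k (Module.finrank F K) = 1 → ¬ k ≡ 0 [MOD Module.finrank F K] :=
    fun k hk hk0 => h1 (by
      rw [← hk, Nat.gcd_eq_right ((Nat.modEq_zero_iff_dvd).1 hk0)])
  refine ⟨modEq_or_modEq_neg_of_weaklyEquivalent s s' t' a b (hne s hs) (hne s' hs') hgi, ?_⟩
  rintro (h | h)
  · let E := Equiv.ofBijective _ hfb
    have hE : ∀ x, E x = (qtPolynomial (Nat.card F) (Module.finrank F K) t' s a).eval x :=
      fun _ => rfl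
    let ψ : L →ₗ[K] L :=
      { toFun := fun y => (qtPolynomial (Nat.card F) (Module.finrank F K) t' s' b).eval (E.symm y)
        map_add' := fun x y => by
          rw [← hga]
          congr 1
          rw [Equiv.symm_apply_eq, hE, hfa, ← hE, ← hE, E.apply_symm_apply, E.apply_symm_apply]
        map_smul' := fun μ y => by
          -- The inverse of f twists scalars by the inverse Frobenius power, so μ is written as a
          -- q^s-th power.
          obtain ⟨ν, rfl⟩ : ∃ ν : K, ν ^ (Nat.card F ^ s) = μ := by
            refine Finite.injective_iff_surjective.1 ?_ μ
            have : (fun ν : K => ν ^ (Nat.card F ^ s)) = frobeniusPow F K s :=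
              funext fun ν => (frobeniusPow_apply s ν).symm
            rw [this]
            refine (injective_iff_map_eq_zero _).2 fun ν hν => ?_
            rw [frobeniusPow_apply] at hν
            exact eq_zero_of_pow_eq_zero hν
          rw [RingHom.id_apply, hpow s s' h ν, ← hgs]
          congr 1
          rw [Equiv.symm_apply_eq, hE, hfs, ← hE, E.apply_symm_apply, hpow s s' h ν] }
    have hψ : Function.Bijective ψ := hgb.comp E.symm.bijective
    refine weaklyEquivalent_of_comp_eq (LinearEquiv.ofBijective ψ hψ) fun x => ?_
    change eval (E.symm (E x)) _ = _
    rw [E.symm_apply_apply]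
  -- The twists of f and g compose to μ^(q^(s+s')) = μ.
  · let ψ : L →ₗ[K] L :=
      { toFun := fun x => (qtPolynomial (Nat.card F) (Module.finrank F K) t' s' b).eval
          ((qtPolynomial (Nat.card F) (Module.finrank F K) t' s a).eval x)
        map_add' := fun x y => by rw [hfa, hga]
        map_smul' := fun μ x => by
          rw [hfs, hgs, ← pow_mul, ← pow_add, hpow _ _ h μ, pow_zero, pow_one, RingHom.id_apply] }
    exact weaklyEquivalent_of_eval_eval (LinearEquiv.ofBijective ψ (hgb.comp hfb)) hfb.2
      fun x => rfl
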